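/- All graphs are finite and simple. A graph $G$ is \emph{3-connected} if deleting any set of at most two vertices from $G$ leaves a (non-empty) connected graph. For an edge $e$ of $G$, the graph $G/e$ is obtained by contracting $e$, that is, by identifying the two ends of $e$ and discarding any resulting loops and multiple edges. A graph $H$ is a \emph{minor} of $G$ if, up to isomorphism, $H$ can be obtained from a subgraph of $G$ by zero or more edge contractions, and the \emph{Hadwiger number} $h(G)$ is the maximum $n$ such that the complete graph $K_n$ is a minor of $G$. Every 3-connected graph $G$ that is not complete has an edge $e$ such that $G/e$ is 3-connected and $h(G/e)=h(G)$. -/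

import Mathlib

namespace SimpleGraph

universe u w

/-- `G` is 3-connected: deleting any at most two vertices leaves a connected graph.
(`Connected` includes having at least one vertex, so such a graph has at least three vertices.) -/
def IsThreeConnected {V : Type u} (G : SimpleGraph V) : Prop :=
  ∀ S : Set V, S.encard ≤ 2 → (G.induce Sᶜ).Connected

/-- The equivalence relation on vertices that identifies the two ends of `e` and nothing else. -/
def endsSetoid {V : Type u} (e : Sym2 V) : Setoid V where
  r x y := x = y ∨ (x ∈ e ∧ y ∈ e)
  iseqv :=
    { refl := fun _ => Or.inl rfl
      symm := by
        rintro x y (h | ⟨hx, hy⟩)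
        · exact Or.inl h.symm
        · exact Or.inr ⟨hy, hx⟩
      trans := by
        rintro x y z (rfl | ⟨hx, hy⟩) (rfl | ⟨hy', hz⟩)
        · exact Or.inl rfl
        · exact Or.inr ⟨hy', hz⟩
        · exact Or.inr ⟨hx, hy⟩
        · exact Or.inr ⟨hx, hz⟩ }

/-- The simple graph `G / e`: the ends of `e` are identified, and loops and parallel edges are
discarded. Two distinct classes are adjacent iff some representatives are adjacent in `G`. -/
def contractEdge {V : Type u} (G : SimpleGraph V) (e : Sym2 V) :
    SimpleGraph (Quotient (endsSetoid e)) :=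
  G.map (Quotient.mk (endsSetoid e))

/-- `ContractsTo H G`: up to isomorphism, `H` is obtained from `G` by zero or more successive
edge contractions. -/
inductive ContractsTo {W : Type w} (H : SimpleGraph W) :
    {V : Type u} → SimpleGraph V → Prop
  | of_iso {V : Type u} {G : SimpleGraph V} (φ : G ≃g H) : ContractsTo H G
  | step {V : Type u} {G : SimpleGraph V} (e : Sym2 V) (he : e ∈ G.edgeSet)
      (h : ContractsTo H (G.contractEdge e)) : ContractsTo H G

/-- `H` is a minor of `G`: it is obtained from a subgraph of `G` by zero or more edge
contractions. -/
def IsMinor {W : Type w} {V : Type u} (H : SimpleGraph W) (G : SimpleGraph V) : Prop :=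
  ∃ G' : G.Subgraph, ContractsTo H G'.coe

/-- The Hadwiger number: the maximum `n` such that the complete graph on `n` vertices is a minor
of `G`. For finite graphs the maximum exists, see `isGreatest_hadwigerNumber`. -/
noncomputable def hadwigerNumber {V : Type u} (G : SimpleGraph V) : ℕ :=
  sSup {n : ℕ | IsMinor (completeGraph (Fin n)) G}

theorem ContractsTo.card_le {W : Type w} {H : SimpleGraph W} {V : Type u} {G : SimpleGraph V}
    (h : ContractsTo H G) (hV : Finite V) : Nat.card W ≤ Nat.card V := by
  induction h with
  | of_iso φ => exact (Nat.card_congr φ.toEquiv).ge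
  | step e he h ih =>
    exact (ih inferInstance).trans (Nat.card_le_card_of_surjective _ Quotient.mk_surjective)

theorem isGreatest_hadwigerNumber {V : Type u} [Finite V] (G : SimpleGraph V) :
    IsGreatest {n : ℕ | IsMinor (completeGraph (Fin n)) G} (hadwigerNumber G) := by
  have hb : BddAbove {n : ℕ | IsMinor (completeGraph (Fin n)) G} := by
    refine ⟨Nat.card V, ?_⟩
    rintro n ⟨G', h⟩
    have := (h.card_le inferInstance).trans
      (Nat.card_le_card_of_injective (Subtype.val : G'.verts → V) Subtype.val_injective)
    simpa using this
  have hne : {n : ℕ | IsMinor (completeGraph (Fin n)) G}.Nonempty := by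
    refine ⟨0, ⊥, ContractsTo.of_iso ⟨⟨fun x => x.2.elim, fun x => x.elim0, ?_, ?_⟩, ?_⟩⟩
    · intro x; exact x.2.elim
    · intro x; exact x.elim0
    · intro x; exact x.2.elim
  exact ⟨Nat.sSup_mem hne hb, fun n hn => le_csSup hb hn⟩

end SimpleGraph

/-!
Write `n = h(G)`. A `K_n`-minor of a connected graph `G` is the same as a *clique model* with `n`
colours: a map `c : V → Fin n` with connected fibres, any two of which are joined by an edge
(`IsMinor.exists_isCliqueModel`, `IsCliqueModel.isMinor`). Clique
models of `G / e` pull back to `G` (`IsCliqueModel.of_contractEdge`), and contracting an edge inside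
a fibre keeps a clique model (`IsCliqueModel.contractEdge`). So it suffices to find a clique model
with `n` colours and an edge `xy` inside a fibre such that `G / xy` is 3-connected
(`IsCliqueModel.exists_isCliqueModel_contractible`).

Since `G` is not complete, any clique model has an edge `xy` inside a fibre. If `G / xy` is
not 3-connected, then `T = {x, y, z}` separates `G` for some `z`. The fibres other than those of `x`
and `z` avoid `T`, so they all lie in one component of `G - T`, and some other component `F` only
has the colours of `x` and `z`. Among all clique models and all such `x, y, z, F`, take one with `F`
as small as possible, and recolour all of `F` with the colour of `z`. The fibre of `x` stays connected because of the edge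
`xy`, and the fibres of `x` and `z` stay adjacent because `x` has a neighbour in `F`; so this is
again a clique model (`IsCliqueModel.recolor`). Now `z` has a neighbour `u` in `F`, and `zu` is an
edge inside a fibre. If `G / zu` is not 3-connected either, then `{z, u, v}` separates `G` for some
`v`, and as `x` and `y` are adjacent, some component `D` of `G - {z, u, v}` contains neither.
It contains a neighbour of `u`, which must lie in `F`, whence `D ⊆ F \ {u}`: this contradicts
the choice of `F` (`IsCliqueModel.exists_contractible_of_separator`).
-/

namespace SimpleGraph

universe u w

/-! ### Reachability -/

theorem Reachable.of_closed {V : Type*} {G : SimpleGraph V} {P : V → Prop}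
    {a b : V} (h : G.Reachable a b) (hP : ∀ a b, G.Adj a b → P a → P b) (ha : P a) : P b := by
  rw [reachable_iff_reflTransGen] at h
  induction h with
  | refl => exact ha
  | tail _ hbc ih => exact hP _ _ hbc ih

theorem Reachable.lift_of_adj {V W : Type*} {G : SimpleGraph V} {H : SimpleGraph W}
    {a b : V} (h : G.Reachable a b) (f : V → W)
    (hf : ∀ a b, G.Adj a b → H.Reachable (f a) (f b)) :
    H.Reachable (f a) (f b) :=
  h.of_closed (P := fun v => H.Reachable (f a) (f v)) (fun _ _ hcd hc => hc.trans (hf _ _ hcd))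
    (Reachable.refl _)

/-- The graph `G - T`, on the same vertex set: the vertices of `T` become isolated. -/
def avoid {V : Type u} (G : SimpleGraph V) (T : Set V) : SimpleGraph V where
  Adj a b := G.Adj a b ∧ a ∉ T ∧ b ∉ T
  symm := ⟨fun _ _ h => ⟨h.1.symm, h.2.2, h.2.1⟩⟩
  loopless := ⟨fun _ h => h.1.ne rfl⟩

/-- The subgraph of the edges of `G` whose two ends have the same colour under `c`. -/
def within {V : Type u} {W : Type w} (G : SimpleGraph V) (c : V → W) : SimpleGraph V where
  Adj a b := G.Adj a b ∧ c a = c b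
  symm := ⟨fun _ _ h => ⟨h.1.symm, h.2.symm⟩⟩
  loopless := ⟨fun _ h => h.1.ne rfl⟩

/-- The vertex set of the component of `a` in `G - T`, provided that `a ∉ T`. -/
def compAvoid {V : Type u} (G : SimpleGraph V) (T : Set V) (a : V) : Set V :=
  {v | (G.avoid T).Reachable a v}

theorem notMem_of_mem_compAvoid {V : Type u} {G : SimpleGraph V} {T : Set V} {a v : V}
    (ha : a ∉ T) (h : v ∈ G.compAvoid T a) : v ∉ T :=
  Reachable.of_closed (G := G.avoid T) h (fun _ _ hbc _ => hbc.2.2) ha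

theorem compAvoid_closed {V : Type u} {G : SimpleGraph V} {T : Set V} {a v w : V}
    (ha : a ∉ T) (h : v ∈ G.compAvoid T a) (hvw : G.Adj v w) (hw : w ∉ T) :
    w ∈ G.compAvoid T a :=
  Reachable.trans h (Adj.reachable (⟨hvw, notMem_of_mem_compAvoid ha h, hw⟩ : (G.avoid T).Adj v w))

theorem connected_induce_compl_iff {V : Type u} {G : SimpleGraph V} {S : Set V} :
    (G.induce Sᶜ).Connected ↔
      (∃ a, a ∉ S) ∧ ∀ a b, a ∉ S → b ∉ S → (G.avoid S).Reachable a b := by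
  constructor
  · intro h
    obtain ⟨a⟩ := h.nonempty
    refine ⟨⟨a.1, a.2⟩, fun a b ha hb => ?_⟩
    exact (h.preconnected ⟨a, ha⟩ ⟨b, hb⟩).lift_of_adj Subtype.val
      fun p q hpq => Adj.reachable (⟨hpq, p.2, q.2⟩ : (G.avoid S).Adj p q)
  · rintro ⟨⟨a, ha⟩, h⟩
    have : Nonempty ↥Sᶜ := ⟨⟨a, ha⟩⟩
    refine ⟨fun p q => ?_⟩
    have key := (h p q p.2 q.2).of_closed
      (P := fun v => ∃ hv : v ∈ Sᶜ, (G.induce Sᶜ).Reachable p ⟨v, hv⟩)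
      (fun b c hbc hb => ⟨hbc.2.2, hb.2.trans (Adj.reachable (by exact hbc.1))⟩)
      ⟨p.2, Reachable.refl _⟩
    exact key.2

/-! ### 3-connected graphs -/

theorem IsThreeConnected.reachable {V : Type u} {G : SimpleGraph V} (hG : G.IsThreeConnected)
    (x y : V) {a b : V} (ha : a ∉ ({x, y} : Set V)) (hb : b ∉ ({x, y} : Set V)) :
    (G.avoid {x, y}).Reachable a b :=
  have hle : ({x, y} : Set V).encard ≤ 2 :=
    (Set.encard_insert_le {y} x).trans (by simp [one_add_one_eq_two])
  (connected_induce_compl_iff.1 (hG {x, y} hle)).2 a b ha hb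

theorem IsThreeConnected.connected {V : Type u} {G : SimpleGraph V} (hG : G.IsThreeConnected) :
    G.Connected := by
  obtain ⟨⟨a, -⟩, h⟩ := connected_induce_compl_iff.1 (hG ∅ (by simp))
  have : Nonempty V := ⟨a⟩
  refine ⟨fun p q => (h p q (by simp) (by simp)).mono ?_⟩
  exact fun _ _ hpq => hpq.1

/-- Each vertex of a 3-separator has a neighbour in each component; stated for the vertex `z`
of the separator `{x, y, z}`. -/
theorem IsThreeConnected.exists_adj_mem {V : Type u} {G : SimpleGraph V}
    (hG : G.IsThreeConnected) {x y z a b : V} {T : Set V} (hT : T = {x, y, z})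
    (ha : a ∉ T) (hb : b ∉ T) (hab : b ∉ G.compAvoid T a) :
    ∃ d ∈ G.compAvoid T a, G.Adj z d := by
  by_contra! hz
  apply hab
  have hTxy : ∀ v, v ∉ T → v ∉ ({x, y} : Set V) := by
    rintro v hv (rfl | rfl) <;> apply hv <;> simp [hT]
  refine (hG.reachable x y (hTxy a ha) (hTxy b hb)).of_closed (P := (· ∈ G.compAvoid T a))
    (fun p q hpq hp => ?_) (Reachable.refl _)
  refine compAvoid_closed ha hp hpq.1 ?_
  have h1 := hpq.2.2
  have h2 : q ≠ z := by rintro rfl; exact hz p hp hpq.1.symm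
  simp only [Set.mem_insert_iff, Set.mem_singleton_iff, not_or, hT] at h1 ⊢
  exact ⟨h1.1, h1.2, h2⟩

theorem contractEdge_adj_mk {V : Type u} {G : SimpleGraph V} {e : Sym2 V} {a b : V}
    (h : G.Adj a b) (hne : (Quotient.mk (endsSetoid e) a) ≠ Quotient.mk (endsSetoid e) b) :
    (G.contractEdge e).Adj (Quotient.mk (endsSetoid e) a) (Quotient.mk (endsSetoid e) b) :=
  ⟨hne, a, b, h, rfl, rfl⟩

theorem mk_endsSetoid_eq_iff {V : Type u} {e : Sym2 V} {a b : V} :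
    Quotient.mk (endsSetoid e) a = Quotient.mk (endsSetoid e) b ↔ a = b ∨ (a ∈ e ∧ b ∈ e) :=
  Quotient.eq

/-- If `G / xy` is not 3-connected, then `x` and `y` lie in a separator `{x, y, z}`. -/
theorem IsThreeConnected.exists_separator {V : Type u} {G : SimpleGraph V}
    (hG : G.IsThreeConnected) (hnc : G ≠ completeGraph V) {x y : V}
    (hn : ¬ (G.contractEdge s(x, y)).IsThreeConnected) :
    ∃ z a b, a ∉ ({x, y, z} : Set V) ∧ b ∉ ({x, y, z} : Set V) ∧
      b ∉ G.compAvoid {x, y, z} a := by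
  by_contra! hcon
  apply hn
  intro S hS
  set q : V → Quotient (endsSetoid s(x, y)) := Quotient.mk _ with hq
  -- It is enough to show that the preimage of `S` does not separate `G`.
  suffices h : (G.induce (q ⁻¹' S)ᶜ).Connected by
    rw [connected_induce_compl_iff] at h ⊢
    obtain ⟨⟨a, ha⟩, h⟩ := h
    refine ⟨⟨q a, ha⟩, ?_⟩
    intro p p' hp hp'
    induction p using Quotient.inductionOn
    induction p' using Quotient.inductionOn
    refine (h _ _ hp hp').lift_of_adj q fun b c hbc => ?_
    by_cases hqq : q b = q c
    · rw [hqq]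
    · exact Adj.reachable ⟨contractEdge_adj_mk hbc.1 hqq, hbc.2.1, hbc.2.2⟩
  by_cases hxS : q x ∈ S
  · have hxy : q y = q x := by simp [hq, mk_endsSetoid_eq_iff]
    -- The part of `S` other than the contracted vertex has at most one element.
    obtain ⟨z, hz⟩ : ∃ z, q ⁻¹' S = {x, y, z} := by
      have hle : (S \ {q x}).encard ≤ 1 := by
        rw [← Set.encard_sdiff_singleton_add_one hxS] at hS
        exact (ENat.add_le_add_iff_right ENat.one_ne_top).1 (by simpa [one_add_one_eq_two] using hS)
      rw [Set.encard_le_one_iff] at hle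
      by_cases hex : ∃ z, q z ∈ S ∧ q z ≠ q x
      · obtain ⟨z, hzS, hzx⟩ := hex
        refine ⟨z, Set.ext fun v => ?_⟩
        simp only [Set.mem_preimage, Set.mem_insert_iff, Set.mem_singleton_iff]
        constructor
        · intro hv
          by_cases hvx : q v = q x
          · have := mk_endsSetoid_eq_iff.1 hvx
            simp only [Sym2.mem_iff] at this
            tauto
          · have := mk_endsSetoid_eq_iff.1 (hle (q v) (q z) ⟨hv, hvx⟩ ⟨hzS, hzx⟩)
            have hzx' : ¬ z ∈ s(x, y) :=
              fun hm => hzx (mk_endsSetoid_eq_iff.2 (Or.inr ⟨hm, by simp⟩))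
            tauto
        · rintro (rfl | rfl | rfl)
          · exact hxS
          · exact hxy ▸ hxS
          · exact hzS
      · push Not at hex
        refine ⟨x, Set.ext fun v => ?_⟩
        simp only [Set.mem_preimage, Set.mem_insert_iff, Set.mem_singleton_iff]
        constructor
        · intro hv
          have := mk_endsSetoid_eq_iff.1 (hex v hv)
          simp only [Sym2.mem_iff] at this
          tauto
        · rintro (rfl | rfl | rfl)
          · exact hxS
          · exact hxy ▸ hxS
          · exact hxS
    rw [connected_induce_compl_iff, hz]
    refine ⟨?_, fun a b ha hb => hcon z a b ha hb⟩
    -- If `{x, y, z}` is all of `V`, then `G` is complete: two non-adjacent vertices would be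
    -- separated by the third.
    by_contra! hall
    apply hnc
    have hall' : ∀ v, v = x ∨ v = y ∨ v = z := by simpa using hall
    ext a b
    refine ⟨fun h => h.ne, fun hab => ?_⟩
    have hab : a ≠ b := hab
    obtain ⟨t, ht⟩ : ∃ t, ∀ v, v = a ∨ v = b ∨ v = t := by
      have ha := hall' a
      have hb := hall' b
      rcases ha with ha | ha | ha <;> rcases hb with hb | hb | hb <;>
        first
        | exact absurd (ha.trans hb.symm) hab
        | (refine ⟨x, fun v => ?_⟩; rcases hall' v with h | h | h <;> simp [h, ha, hb]; done)
        | (refine ⟨y, fun v => ?_⟩; rcases hall' v with h | h | h <;> simp [h, ha, hb]; done)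
        | (refine ⟨z, fun v => ?_⟩; rcases hall' v with h | h | h <;> simp [h, ha, hb])
    by_contra hnadj
    by_cases hta : t = a ∨ t = b
    · have hr := hG.connected.preconnected a b
      refine hab (hr.of_closed (P := fun v => a = v) (fun c d hcd hc => ?_) rfl)
      subst hc
      rcases ht d with h | h | h <;> grind [SimpleGraph.irrefl]
    · have hr := hG.reachable t t (a := a) (b := b) (by grind) (by grind)
      refine hab (hr.of_closed (P := fun v => a = v) (fun c d hcd hc => ?_) rfl)
      subst hc
      obtain ⟨h1, -, h2⟩ := hcd
      rcases ht d with h | h | h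
      · exact h.symm
      · exact absurd (h ▸ h1) hnadj
      · exact absurd (by simp [h]) h2
  · -- The contracted vertex is not in `S`, so the preimage of `S` is no larger than `S`.
    refine hG _ (le_trans ?_ hS)
    have hinj : Set.InjOn q (q ⁻¹' S) := by
      intro a ha b hb hab
      rcases mk_endsSetoid_eq_iff.1 hab with h | ⟨h, -⟩
      · exact h
      · have hax : q a = q x := mk_endsSetoid_eq_iff.2 (Or.inr ⟨h, by simp⟩)
        rw [Set.mem_preimage, hax] at ha
        exact absurd ha hxS
    rw [← hinj.encard_image]
    exact Set.encard_le_encard (Set.image_preimage_subset q S)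

/-! ### Clique models -/

/-- A clique model in `G` with set of colours `W`, spanning `G`: the fibres of `c` are non-empty,
connected (any two vertices of a fibre are joined by a path inside it), and pairwise adjacent. -/
structure IsCliqueModel {V : Type u} {W : Type w} (G : SimpleGraph V) (c : V → W) : Prop where
  surj : Function.Surjective c
  reach : ∀ a b, c a = c b → (G.within c).Reachable a b
  adj : ∀ v w, v ≠ w → ∃ a b, c a = v ∧ c b = w ∧ G.Adj a b

theorem IsCliqueModel.comp_iso {V V' : Type*} {W : Type w} {G : SimpleGraph V}
    {G' : SimpleGraph V'} {c : V → W} (h : G.IsCliqueModel c) (φ : G' ≃g G) :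
    G'.IsCliqueModel (c ∘ φ) where
  surj := h.surj.comp φ.surjective
  reach a b hab := by
    have := (h.reach _ _ hab).lift_of_adj (H := G'.within (c ∘ φ)) φ.symm fun p q hpq =>
      Adj.reachable ⟨φ.symm.map_adj_iff.2 hpq.1, by simpa using hpq.2⟩
    simpa using this
  adj v w hvw := by
    obtain ⟨a, b, rfl, rfl, hab⟩ := h.adj v w hvw
    exact ⟨φ.symm a, φ.symm b, by simp, by simp, φ.symm.map_adj_iff.2 hab⟩

/-- Contracting an edge inside a fibre keeps a clique model. -/
theorem IsCliqueModel.contractEdge {V : Type u} {W : Type w} {G : SimpleGraph V} {c : V → W}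
    (h : G.IsCliqueModel c) {x y : V} (hxy : c x = c y) :
    ∃ c' : Quotient (endsSetoid s(x, y)) → W, (G.contractEdge s(x, y)).IsCliqueModel c' := by
  have hc : ∀ a b, (endsSetoid s(x, y)) a b → c a = c b := by
    rintro a b (rfl | ⟨ha, hb⟩)
    · rfl
    · simp only [Sym2.mem_iff] at ha hb
      rcases ha with rfl | rfl <;> rcases hb with rfl | rfl <;> simp [hxy]
  refine ⟨Quotient.lift c hc, ⟨?_, ?_, ?_⟩⟩
  · intro w
    obtain ⟨a, rfl⟩ := h.surj w
    exact ⟨Quotient.mk _ a, rfl⟩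
  · intro p q hpq
    induction p using Quotient.inductionOn
    induction q using Quotient.inductionOn
    refine (h.reach _ _ hpq).lift_of_adj (Quotient.mk _) fun a b hab => ?_
    by_cases hqq : Quotient.mk (endsSetoid s(x, y)) a = Quotient.mk _ b
    · rw [hqq]
    · exact Adj.reachable ⟨contractEdge_adj_mk hab.1 hqq, hab.2⟩
  · intro v w hvw
    obtain ⟨a, b, rfl, rfl, hab⟩ := h.adj v w hvw
    refine ⟨Quotient.mk _ a, Quotient.mk _ b, rfl, rfl, contractEdge_adj_mk hab fun hqq => hvw ?_⟩
    exact hc a b (Quotient.eq.1 hqq)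

/-- A clique model of `G / e` pulls back to one of `G`. -/
theorem IsCliqueModel.of_contractEdge {V : Type u} {W : Type w} {G : SimpleGraph V} {e : Sym2 V}
    (he : e ∈ G.edgeSet) {c : Quotient (endsSetoid e) → W}
    (h : (G.contractEdge e).IsCliqueModel c) :
    G.IsCliqueModel (c ∘ Quotient.mk (endsSetoid e)) := by
  set q : V → Quotient (endsSetoid e) := Quotient.mk _ with hq
  have hclass : ∀ a b, q a = q b → (G.within (c ∘ q)).Reachable a b := by
    intro a b hab
    rcases mk_endsSetoid_eq_iff.1 hab with rfl | ⟨ha, hb⟩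
    · exact Reachable.refl _
    · by_cases hne : a = b
      · rw [hne]
      · obtain rfl := (Sym2.mem_and_mem_iff hne).1 ⟨ha, hb⟩
        exact Adj.reachable ⟨he, congrArg c hab⟩
  refine ⟨h.surj.comp Quotient.mk_surjective, fun a b hab => ?_, fun v w hvw => ?_⟩
  · refine (h.reach (q a) (q b) hab).of_closed
      (P := fun p => ∀ d, q d = p → (G.within (c ∘ q)).Reachable a d) ?_
      (fun d hd => hclass a d hd.symm) b rfl
    rintro p p' ⟨⟨-, s, t, hst, hs, ht⟩, hpp'⟩ hp d hd
    have hadj : (G.within (c ∘ q)).Adj s t := ⟨hst, by simp [hq, hs, ht, hpp']⟩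
    exact ((hp s hs).trans hadj.reachable).trans (hclass t d (ht.trans hd.symm))
  · obtain ⟨p, p', hp, hp', ⟨-, s, t, hst, hs, ht⟩⟩ := h.adj v w hvw
    exact ⟨s, t, by simp [hq, hs, hp], by simp [hq, ht, hp'], hst⟩

theorem ContractsTo.exists_isCliqueModel {W : Type w} {V : Type u} {G : SimpleGraph V}
    (h : ContractsTo (completeGraph W) G) : ∃ c : V → W, G.IsCliqueModel c := by
  induction h with
  | of_iso φ =>
    refine ⟨φ, φ.surjective, fun a b hab => ?_, fun v w hvw => ?_⟩
    · rw [φ.injective hab]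
    · exact ⟨φ.symm v, φ.symm w, by simp, by simp, φ.symm.map_adj_iff.2 hvw⟩
  | step e he _ ih =>
    obtain ⟨c, hc⟩ := ih
    exact ⟨_, hc.of_contractEdge he⟩

theorem IsCliqueModel.exists_adj_of_not_injective {V : Type u} {W : Type w} {G : SimpleGraph V}
    {c : V → W} (h : G.IsCliqueModel c) (hinj : ¬ Function.Injective c) :
    ∃ x y, G.Adj x y ∧ c x = c y := by
  simp only [Function.Injective, not_forall] at hinj
  obtain ⟨a, b, hab, hne⟩ := hinj
  by_contra! hno
  exact hne ((h.reach a b hab).of_closed (P := fun v => a = v)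
    (fun p q hpq _ => absurd hpq.2 (hno p q hpq.1)) rfl)

theorem IsCliqueModel.adj_of_injective {V : Type u} {W : Type w} {G : SimpleGraph V}
    {c : V → W} (h : G.IsCliqueModel c) (hinj : Function.Injective c) {a b : V} (hab : a ≠ b) :
    G.Adj a b := by
  obtain ⟨a', b', ha, hb, hadj⟩ := h.adj (c a) (c b) (hinj.ne hab)
  rwa [hinj ha, hinj hb] at hadj

theorem IsCliqueModel.contractsTo {W : Type w} {V : Type u} [Finite V] {G : SimpleGraph V}
    {c : V → W} (h : G.IsCliqueModel c) : ContractsTo (completeGraph W) G := by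
  induction hk : Nat.card V using Nat.strong_induction_on generalizing V with
  | _ k ih =>
    by_cases hinj : Function.Injective c
    · refine .of_iso ⟨Equiv.ofBijective c ⟨hinj, h.surj⟩, fun {a b} => ?_⟩
      exact ⟨fun hab => h.adj_of_injective hinj fun e => hab (congrArg c e),
        fun hab => hinj.ne hab.ne⟩
    · obtain ⟨x, y, hadj, hxy⟩ := h.exists_adj_of_not_injective hinj
      obtain ⟨c', hc'⟩ := h.contractEdge hxy
      refine .step s(x, y) hadj (ih _ ?_ hc' rfl)
      rw [← hk]
      have := Fintype.ofFinite V
      have := Fintype.ofFinite (Quotient (endsSetoid s(x, y)))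
      rw [Nat.card_eq_fintype_card, Nat.card_eq_fintype_card]
      refine Fintype.card_lt_of_surjective_not_injective _
        (Quotient.mk_surjective (s := endsSetoid s(x, y))) fun hi => hadj.ne (hi ?_)
      simp [mk_endsSetoid_eq_iff]

theorem IsCliqueModel.isMinor {W : Type w} {V : Type u} [Finite V] {G : SimpleGraph V}
    {c : V → W} (h : G.IsCliqueModel c) : IsMinor (completeGraph W) G :=
  ⟨⊤, (h.comp_iso Subgraph.topIso).contractsTo⟩

/-- In a connected graph, the vertices of a non-empty set `S` can be grown to disjoint connected
subgraphs that cover the whole graph. -/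
theorem Connected.exists_retraction {V : Type u} [Finite V] {G : SimpleGraph V}
    (hG : G.Connected) {S : Set V} (hS : S.Nonempty) :
    ∃ r : V → S, (∀ s : S, r s = s) ∧ ∀ v, (G.within r).Reachable v (r v) := by
  classical
  obtain ⟨s₀, hs₀⟩ := hS
  -- Take a largest set `A` on which such a map exists.
  let P : Set V → Prop := fun A => S ⊆ A ∧ ∃ r : V → S, (∀ s : S, r s = s) ∧
    ∀ v ∈ A, ((G.within r).avoid Aᶜ).Reachable v (r v)
  have hPS : P S := by
    refine ⟨subset_rfl, fun v => if h : v ∈ S then ⟨v, h⟩ else ⟨s₀, hs₀⟩, by simp, fun v hv => ?_⟩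
    simp [hv]
  obtain ⟨A, hA⟩ := (Set.toFinite {A | P A}).exists_maximal ⟨S, hPS⟩
  obtain ⟨hSA, r, hrS, hr⟩ := hA.prop
  suffices hAu : A = Set.univ by
    refine ⟨r, hrS, fun v => (hr v (hAu ▸ Set.mem_univ v)).mono ?_⟩
    exact fun _ _ h => h.1
  by_contra hAu
  obtain ⟨t₀, ht₀⟩ := (Set.ne_univ_iff_exists_notMem A).1 hAu
  obtain ⟨p, t, hp, ht, hpt⟩ : ∃ p t, p ∈ A ∧ t ∉ A ∧ G.Adj p t := by
    by_contra! hno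
    exact ht₀ ((hG.preconnected s₀ t₀).of_closed (P := (· ∈ A))
      (fun a b hab ha => by_contra fun hb => hno a b ha hb hab) (hSA hs₀))
  have hle : A ⊆ insert t A := Set.subset_insert t A
  refine ht (hA.le_of_ge (y := insert t A) ⟨hSA.trans hle, Function.update r t (r p), ?_, ?_⟩ hle
    (Set.mem_insert t A))
  · intro s
    rw [Function.update_of_ne (fun h : (s : V) = t => ht (h ▸ hSA s.2)), hrS]
  · have hold : ∀ v ∈ A, ((G.within (Function.update r t (r p))).avoid (insert t A)ᶜ).Reachable v
        (r v) := by
      intro v hv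
      refine (hr v hv).mono ?_
      rintro a b ⟨⟨hab, hrab⟩, ha, hb⟩
      rw [Set.notMem_compl_iff] at ha hb
      refine ⟨⟨hab, ?_⟩, by simp [ha], by simp [hb]⟩
      rw [Function.update_of_ne (by rintro rfl; exact ht ha),
        Function.update_of_ne (by rintro rfl; exact ht hb), hrab]
    rintro v (rfl | hv)
    · rw [Function.update_self]
      refine (Adj.reachable ?_).trans (hold p hp)
      refine ⟨⟨hpt.symm, ?_⟩, by simp, by simp [hp]⟩
      rw [Function.update_self, Function.update_of_ne hpt.ne]
    · rw [Function.update_of_ne (by rintro rfl; exact ht hv)]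
      exact hold v hv

/-- A non-empty clique minor of a connected graph comes from a clique model that spans the
graph. -/
theorem IsMinor.exists_isCliqueModel {W : Type w} [Nonempty W] {V : Type u} [Finite V]
    {G : SimpleGraph V} (hG : G.Connected) (h : IsMinor (completeGraph W) G) :
    ∃ c : V → W, G.IsCliqueModel c := by
  obtain ⟨G', hG'⟩ := h
  obtain ⟨c, hc⟩ := hG'.exists_isCliqueModel
  obtain ⟨s₀, -⟩ := hc.surj (Classical.arbitrary W)
  obtain ⟨r, hrS, hr⟩ := hG.exists_retraction ⟨s₀.1, s₀.2⟩
  have hr' : ∀ v, (G.within (c ∘ r)).Reachable v (r v) := by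
    refine fun v => (hr v).mono ?_
    exact fun _ _ hab => ⟨hab.1, congrArg c hab.2⟩
  refine ⟨c ∘ r, fun w => ?_, fun a b hab => ?_, fun v w hvw => ?_⟩
  · obtain ⟨s, rfl⟩ := hc.surj w
    exact ⟨s, by simp [hrS]⟩
  · refine (hr' a).trans (Reachable.trans ?_ (hr' b).symm)
    refine (hc.reach (r a) (r b) hab).lift_of_adj Subtype.val fun s t hst => Adj.reachable ?_
    exact ⟨hst.1.adj_sub, by simpa [hrS] using hst.2⟩
  · obtain ⟨s, t, rfl, rfl, hst⟩ := hc.adj v w hvw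
    exact ⟨s, t, by simp [hrS], by simp [hrS], hst.adj_sub⟩

/-! ### Recolouring a component -/

open Classical in
/-- Let `F` be a component of `G - {x, y, z}` that has neighbours `x` and `z` and only has the
colours of `x` and `z`, where `xy` is an edge inside a fibre. Then giving all of `F` the colour of
`z` yields a clique model again. -/
theorem IsCliqueModel.recolor {V : Type u} {W : Type w} {G : SimpleGraph V} {c : V → W}
    (h : G.IsCliqueModel c) {x y z a f u : V} {T F : Set V} (hT : T = {x, y, z}) (ha : a ∉ T)
    (hF : F = G.compAvoid T a) (hxy : G.Adj x y) (hcxy : c x = c y)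
    (hcF : ∀ v ∈ F, c v = c x ∨ c v = c z) (hf : f ∈ F) (hxf : G.Adj x f) (hu : u ∈ F)
    (hzu : G.Adj z u) :
    G.IsCliqueModel fun v => if v ∈ F then c z else c v := by
  by_cases hxz : c z = c x
  · have : (fun v => if v ∈ F then c z else c v) = c := by
      funext v
      split_ifs with hv
      · rcases hcF v hv with h | h <;> simp [h, hxz]
      · rfl
    rwa [this]
  set c' : V → W := fun v => if v ∈ F then c z else c v with hc'
  have hin : ∀ v ∈ F, c' v = c z := fun v hv => if_pos hv
  have hout : ∀ v, v ∉ F → c' v = c v := fun v hv => if_neg hv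
  have hFT : ∀ v ∈ F, v ∉ T := fun v hv => notMem_of_mem_compAvoid ha (hF ▸ hv)
  have hxF : x ∉ F := fun hx => hFT x hx (by simp [hT])
  have hyF : y ∉ F := fun hx => hFT y hx (by simp [hT])
  have hzF : z ∉ F := fun hx => hFT z hx (by simp [hT])
  have hnbr : ∀ p q, G.Adj p q → p ∈ F → q ∉ F → q = x ∨ q = y ∨ q = z := by
    intro p q hpq hp hq
    by_contra hqT
    exact hq (hF ▸ compAvoid_closed ha (hF ▸ hp) hpq (by simpa [hT] using hqT))
  have hz' : ∀ v ∈ F, (G.within c').Reachable v z := by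
    intro v hv
    have hadj : (G.within c').Adj u z := ⟨hzu.symm, by rw [hin u hu, hout z hzF]⟩
    refine Reachable.trans ?_ hadj.reachable
    have hvu : (G.avoid T).Reachable v u := by
      rw [hF] at hv hu
      exact Reachable.trans (Reachable.symm hv) hu
    have key := hvu.of_closed (P := fun p => p ∈ F ∧ (G.within c').Reachable v p) ?_
      ⟨hv, Reachable.refl _⟩
    · exact key.2
    · rintro p q hpq ⟨hp, hvp⟩
      have hq : q ∈ F := hF ▸ compAvoid_closed ha (hF ▸ hp) hpq.1 hpq.2.2
      exact ⟨hq, hvp.trans (Adj.reachable ⟨hpq.1, by rw [hin p hp, hin q hq]⟩)⟩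
  -- A path inside an old fibre is pushed out of `F`: it meets `F` in detours that start and end
  -- at `z`, or at `x` or `y`, according to the colour.
  let r : V → V := fun v => if v ∈ F then (if c v = c z then z else x) else v
  have hxyr : (G.within c').Reachable x y :=
    Adj.reachable ⟨hxy, by rw [hout x hxF, hout y hyF, hcxy]⟩
  have hcross : ∀ p q, G.Adj p q → c p = c q → p ∈ F → q ∉ F →
      (G.within c').Reachable (r p) (r q) := by
    intro p q hpq hcpq hp hq
    have hrq : r q = q := if_neg hq
    have hrp : r p = if c p = c z then z else x := if_pos hp
    rw [hrq, hrp]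
    split_ifs with hcp
    · rcases hnbr p q hpq hp hq with rfl | rfl | rfl
      · exact absurd (hcp.symm.trans hcpq) hxz
      · exact absurd (hcp.symm.trans (hcpq.trans hcxy.symm)) hxz
      · exact Reachable.refl _
    · rcases hnbr p q hpq hp hq with rfl | rfl | rfl
      · exact Reachable.refl _
      · exact hxyr
      · exact absurd hcpq hcp
  have hr : ∀ p q, (G.within c).Adj p q → (G.within c').Reachable (r p) (r q) := by
    rintro p q ⟨hpq, hcpq⟩
    by_cases hp : p ∈ F <;> by_cases hq : q ∈ F
    · have : r p = r q := by simp only [r, hp, hq, if_true, hcpq]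
      rw [this]
    · exact hcross p q hpq hcpq hp hq
    · exact (hcross q p hpq.symm hcpq.symm hq hp).symm
    · have hrp : r p = p := if_neg hp
      have hrq : r q = q := if_neg hq
      rw [hrp, hrq]
      exact Adj.reachable ⟨hpq, by rw [hout p hp, hout q hq, hcpq]⟩
  have hreach : ∀ p q, p ∉ F → q ∉ F → c p = c q → (G.within c').Reachable p q := by
    intro p q hp hq hpq
    have := (h.reach p q hpq).lift_of_adj r hr
    rwa [show r p = p from if_neg hp, show r q = q from if_neg hq] at this
  -- Each vertex can be moved out of `F` inside its new fibre.
  have hmove : ∀ p, ∃ p', p' ∉ F ∧ c' p = c p' ∧ (G.within c').Reachable p p' := by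
    intro p
    by_cases hp : p ∈ F
    · exact ⟨z, hzF, hin p hp, hz' p hp⟩
    · exact ⟨p, hp, hout p hp, Reachable.refl _⟩
  refine ⟨fun w => ?_, fun p q hpq => ?_, fun v w hvw => ?_⟩
  · obtain ⟨p, rfl⟩ := h.surj w
    by_cases hp : p ∈ F
    · rcases hcF p hp with h | h
      · exact ⟨x, by rw [hout x hxF, h]⟩
      · exact ⟨z, by rw [hout z hzF, h]⟩
    · exact ⟨p, hout p hp⟩
  · obtain ⟨p', hp', hcp, hpp'⟩ := hmove p
    obtain ⟨q', hq', hcq, hqq'⟩ := hmove q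
    exact (hpp'.trans (hreach p' q' hp' hq' (hcp.symm.trans (hpq.trans hcq)))).trans hqq'.symm
  · obtain ⟨p, q, rfl, rfl, hpq⟩ := h.adj v w hvw
    have hend : ∀ p q, G.Adj p q → p ∈ F → c q = c x ∨ c q = c z := by
      intro p q hpq hp
      by_cases hq : q ∈ F
      · exact hcF q hq
      · rcases hnbr p q hpq hp hq with rfl | rfl | rfl
        · exact Or.inl rfl
        · exact Or.inl hcxy.symm
        · exact Or.inr rfl
    by_cases hpqF : p ∈ F ∨ q ∈ F
    · have h1 : c p = c x ∨ c p = c z := hpqF.elim (hcF p) (hend q p hpq.symm)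
      have h2 : c q = c x ∨ c q = c z := hpqF.elim (hend p q hpq) (hcF q)
      have h3 : c' x = c x := hout x hxF
      have h4 : c' f = c z := hin f hf
      rcases h1 with h1 | h1 <;> rcases h2 with h2 | h2
      · exact absurd (h1.trans h2.symm) hvw
      · exact ⟨x, f, h3.trans h1.symm, h4.trans h2.symm, hxf⟩
      · exact ⟨f, x, h4.trans h1.symm, h3.trans h2.symm, hxf.symm⟩
      · exact absurd (h1.trans h2.symm) hvw
    · push Not at hpqF
      exact ⟨p, q, hout p hpqF.1, hout q hpqF.2, hpq⟩

/-! ### A contractible edge inside a fibre -/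

/-- The descent: from a component `F = G.compAvoid T a` of `G - T`, where `T = {x, y, z}` and `F`
only has the colours of `x` and `z`, one reaches a contractible edge inside a fibre of some clique
model, by induction on the size of `F`. -/
theorem IsCliqueModel.exists_contractible_of_separator {V : Type u} {W : Type w} [Finite V]
    {G : SimpleGraph V} (hG : G.IsThreeConnected) (hnc : G ≠ completeGraph V) {c : V → W}
    (h : G.IsCliqueModel c) {x y z a b : V} {T : Set V} (hT : T = {x, y, z}) (hxy : G.Adj x y)
    (hcxy : c x = c y) (ha : a ∉ T) (hb : b ∉ T) (hab : b ∉ G.compAvoid T a)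
    (hcF : ∀ v ∈ G.compAvoid T a, c v = c x ∨ c v = c z) :
    ∃ (c' : V → W) (p q : V), G.IsCliqueModel c' ∧ G.Adj p q ∧ c' p = c' q ∧
      (G.contractEdge s(p, q)).IsThreeConnected := by
  classical
  induction hk : (G.compAvoid T a).ncard using Nat.strong_induction_on
    generalizing c x y z a b T with
  | _ k ih =>
    set F := G.compAvoid T a with hF
    obtain ⟨u, hu, hzu⟩ := hG.exists_adj_mem hT ha hb hab
    obtain ⟨f, hf, hxf⟩ := hG.exists_adj_mem (x := y) (y := z) (z := x) (by grind) ha hb hab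
    have hFT : ∀ v ∈ F, v ∉ T := fun v hv => notMem_of_mem_compAvoid ha hv
    have hzF : z ∉ F := fun hz => hFT z hz (by simp [hT])
    have hmodel := h.recolor hT ha hF hxy hcxy hcF hf hxf hu hzu
    set c' : V → W := fun v => if v ∈ F then c z else c v with hc'
    have hc'F : ∀ v ∈ F, c' v = c' z := fun v hv => by simp [hc', hv]
    by_cases hcon : (G.contractEdge s(z, u)).IsThreeConnected
    · exact ⟨c', z, u, hmodel, hzu, (hc'F u hu).symm, hcon⟩
    obtain ⟨v, a₀, b₀, ha₀, hb₀, hab₀⟩ := hG.exists_separator hnc hcon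
    set T' : Set V := {z, u, v} with hT'
    -- As `x` and `y` are adjacent, at most one component of `G - T'` meets `{x, y}`.
    obtain ⟨a₁, b₁, ha₁, hb₁, hab₁, hx, hy⟩ : ∃ a₁ b₁, a₁ ∉ T' ∧ b₁ ∉ T' ∧
        b₁ ∉ G.compAvoid T' a₁ ∧ x ∉ G.compAvoid T' a₁ ∧ y ∉ G.compAvoid T' a₁ := by
      by_contra! hno
      have hpick : ∀ a₁ b₁, a₁ ∉ T' → b₁ ∉ T' → b₁ ∉ G.compAvoid T' a₁ →
          ∃ s ∈ G.compAvoid T' a₁, s = x ∨ s = y := by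
        intro a₁ b₁ h1 h2 h3
        by_cases hx : x ∈ G.compAvoid T' a₁
        · exact ⟨x, hx, Or.inl rfl⟩
        · exact ⟨y, hno a₁ b₁ h1 h2 h3 hx, Or.inr rfl⟩
      obtain ⟨s, hs, hsxy⟩ := hpick a₀ b₀ ha₀ hb₀ hab₀
      obtain ⟨t, ht, htxy⟩ := hpick b₀ a₀ hb₀ ha₀ fun hr => hab₀ (Reachable.symm hr)
      have hsT := notMem_of_mem_compAvoid ha₀ hs
      have htT := notMem_of_mem_compAvoid hb₀ ht
      have hst : t ∈ G.compAvoid T' a₀ := by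
        rcases hsxy with rfl | rfl <;> rcases htxy with rfl | rfl
        · exact hs
        · exact compAvoid_closed ha₀ hs hxy htT
        · exact compAvoid_closed ha₀ hs hxy.symm htT
        · exact hs
      exact hab₀ (Reachable.trans hst (Reachable.symm ht))
    set D := G.compAvoid T' a₁ with hD
    have hDT : ∀ p ∈ D, p ∉ T' := fun p hp => notMem_of_mem_compAvoid ha₁ hp
    have hzD : z ∉ D := fun hz => hDT z hz (by simp [hT'])
    have huD : u ∉ D := fun hz => hDT u hz (by simp [hT'])
    have hstep : ∀ p q, G.Adj p q → p ∈ F → q ∈ D → q ∈ F := by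
      intro p q hpq hp hq
      refine compAvoid_closed ha hp hpq fun hqT => ?_
      rw [hT] at hqT
      rcases hqT with rfl | rfl | rfl
      · exact hx hq
      · exact hy hq
      · exact hzD hq
    obtain ⟨d, hd, hud⟩ :=
      hG.exists_adj_mem (x := v) (y := z) (z := u) (by grind) ha₁ hb₁ hab₁
    have hdF : d ∈ F := hstep u d hud hu hd
    have hDF : D ⊆ F := by
      intro p hp
      have hdp : (G.avoid T').Reachable d p := (Reachable.symm hd).trans hp
      refine (hdp.of_closed (P := fun s => s ∈ F ∧ s ∈ D) ?_ ⟨hdF, hd⟩).1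
      rintro s t hst ⟨hsF, hsD⟩
      have htD : t ∈ D := compAvoid_closed ha₁ hsD hst.1 hst.2.2
      exact ⟨hstep s t hst.1 hsF htD, htD⟩
    have hlt : D.ncard < k := by
      rw [← hk]
      exact Set.ncard_lt_ncard ⟨hDF, fun hFD => huD (hFD hu)⟩ (Set.toFinite F)
    exact ih D.ncard hlt hmodel hT' hzu (hc'F u hu).symm ha₁ hb₁ hab₁
      (fun p hp => Or.inl (hc'F p (hDF hp))) rfl

theorem IsCliqueModel.exists_isCliqueModel_contractible {V : Type u} {W : Type w} [Finite V]
    {G : SimpleGraph V} (hG : G.IsThreeConnected) (hnc : G ≠ completeGraph V) {c : V → W}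
    (h : G.IsCliqueModel c) :
    ∃ (c' : V → W) (p q : V), G.IsCliqueModel c' ∧ G.Adj p q ∧ c' p = c' q ∧
      (G.contractEdge s(p, q)).IsThreeConnected := by
  have hinj : ¬ Function.Injective c := by
    intro hinj
    refine hnc ?_
    ext a b
    exact ⟨fun hab => hab.ne, fun hab => h.adj_of_injective hinj hab⟩
  obtain ⟨x, y, hxy, hcxy⟩ := h.exists_adj_of_not_injective hinj
  by_cases hcon : (G.contractEdge s(x, y)).IsThreeConnected
  · exact ⟨c, x, y, h, hxy, hcxy, hcon⟩
  obtain ⟨z, a, b, ha, hb, hab⟩ := hG.exists_separator hnc hcon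
  set T : Set V := {x, y, z} with hT
  have hba : a ∉ G.compAvoid T b := fun hr => hab (Reachable.symm hr)
  -- All vertices with a colour other than those of `x` and `z` lie in one component of `G - T`.
  have hT' : ∀ p ∈ T, c p = c x ∨ c p = c z := by
    rintro p (rfl | rfl | rfl)
    · exact Or.inl rfl
    · exact Or.inl hcxy.symm
    · exact Or.inr rfl
  have hfree : ∀ p q, ¬ (c p = c x ∨ c p = c z) → c p = c q → (G.avoid T).Reachable p q := by
    intro p q hp hpq
    refine ((h.reach p q hpq).of_closed (P := fun s => c p = c s ∧ (G.avoid T).Reachable p s) ?_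
      ⟨rfl, Reachable.refl _⟩).2
    rintro s t ⟨hst, hcst⟩ ⟨hps, hr⟩
    refine ⟨hps.trans hcst, hr.trans (Adj.reachable ⟨hst, fun hs => hp ?_, fun ht => hp ?_⟩)⟩
    · rw [hps]
      exact hT' s hs
    · rw [hps, hcst]
      exact hT' t ht
  by_cases hFa : ∀ v ∈ G.compAvoid T a, c v = c x ∨ c v = c z
  · exact h.exists_contractible_of_separator hG hnc hT hxy hcxy ha hb hab hFa
  by_cases hFb : ∀ v ∈ G.compAvoid T b, c v = c x ∨ c v = c z
  · exact h.exists_contractible_of_separator hG hnc hT hxy hcxy hb ha hba hFb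
  exfalso
  rw [not_forall] at hFa hFb
  obtain ⟨p, hp⟩ := hFa
  obtain ⟨q, hq⟩ := hFb
  rw [Classical.not_imp] at hp hq
  have hpq : (G.avoid T).Reachable p q := by
    by_cases hne : c p = c q
    · exact hfree p q hp.2 hne
    · obtain ⟨p', q', hp', hq', hadj⟩ := h.adj _ _ hne
      refine (hfree p p' hp.2 hp'.symm).trans (Reachable.trans (Adj.reachable ?_)
        (hfree q q' hq.2 hq'.symm).symm)
      exact ⟨hadj, fun hm => hp.2 (hp' ▸ hT' p' hm), fun hm => hq.2 (hq' ▸ hT' q' hm)⟩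
  exact hab ((Reachable.trans hp.1 hpq).trans (Reachable.symm hq.1))

/-! ### The Hadwiger number of a connected graph -/

theorem Connected.one_le_hadwigerNumber {V : Type u} [Finite V] {G : SimpleGraph V}
    (hG : G.Connected) : 1 ≤ G.hadwigerNumber := by
  refine (isGreatest_hadwigerNumber G).2 (IsCliqueModel.isMinor (c := fun _ => (0 : Fin 1)) ?_)
  obtain ⟨a⟩ := hG.nonempty
  refine ⟨fun w => ⟨a, Subsingleton.elim _ _⟩, fun a b _ => ?_,
    fun v w hvw => absurd (Subsingleton.elim v w) hvw⟩
  refine (hG.preconnected a b).mono ?_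
  exact fun _ _ h => ⟨h, rfl⟩

/-- A connected graph has a clique model with as many colours as its Hadwiger number. -/
theorem Connected.exists_isCliqueModel_hadwigerNumber {V : Type u} [Finite V]
    {G : SimpleGraph V} (hG : G.Connected) :
    ∃ c : V → Fin G.hadwigerNumber, G.IsCliqueModel c := by
  have : Nonempty (Fin G.hadwigerNumber) := ⟨⟨0, hG.one_le_hadwigerNumber⟩⟩
  exact (isGreatest_hadwigerNumber G).1.exists_isCliqueModel hG

end SimpleGraph

theorem mainTheorem3 {V : Type*} [Finite V] (G : SimpleGraph V)
    (hG : G.IsThreeConnected) (hnc : G ≠ SimpleGraph.completeGraph V) :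
    ∃ e ∈ G.edgeSet, (G.contractEdge e).IsThreeConnected ∧
      (G.contractEdge e).hadwigerNumber = G.hadwigerNumber := by
  obtain ⟨c₀, hc₀⟩ := hG.connected.exists_isCliqueModel_hadwigerNumber
  obtain ⟨c, x, y, hc, hxy, hcxy, hcon⟩ := hc₀.exists_isCliqueModel_contractible hG hnc
  refine ⟨s(x, y), hxy, hcon, le_antisymm ?_ ?_⟩
  · obtain ⟨c', hc'⟩ := hcon.connected.exists_isCliqueModel_hadwigerNumber
    exact (SimpleGraph.isGreatest_hadwigerNumber G).2 (hc'.of_contractEdge hxy).isMinor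
  · obtain ⟨c', hc'⟩ := hc.contractEdge hcxy
    exact (SimpleGraph.isGreatest_hadwigerNumber _).2 hc'.isMinor
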